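/- Let $H$ be a separable Hilbert space over $\mathbb{R}$ or $\mathbb{C}$. Write $\mathcal{B}(H)$ for the space of bounded linear operators on $H$ with the operator norm, $\mathcal{K}(H)\subseteq\mathcal{B}(H)$ for the subspace of compact operators, $B_{\mathcal{K}(H)}=\{L\in\mathcal{K}(H):\|L\|\le 1\}$ for its closed unit ball, and $d(T,B_{\mathcal{K}(H)})=\inf\{\|T-L\| : L\in B_{\mathcal{K}(H)}\}$. An operator $T\in\mathcal{B}(H)$ is called positive if it is self-adjoint and $\langle Tx,x\rangle\ge 0$ for all $x\in H$. Let $T\in\mathcal{B}(H)$ with $\|T\|\ge 1$. 1. If $T$ is positive, then there is a positive compact operator $K$ on $H$ with $\|K\|\le 1$ and $\|T-K\|=d(T,B_{\mathcal{K}(H)})$. 2. If $T$ is self-adjoint, then there is a self-adjoint compact operator $K$ on $H$ with $\|K\|\le 1$ and $\|T-K\|=d(T,B_{\mathcal{K}(H)})$. -/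

import Mathlib

/-- The closed unit ball `B_{K(H)}` of the space `K(H)` of compact operators on `H`, as a subset of
the space `B(H)` of bounded operators with its operator norm. -/
def compactUnitBall (𝕜 H : Type*) [RCLike 𝕜] [NormedAddCommGroup H] [InnerProductSpace 𝕜 H] :
    Set (H →L[𝕜] H) :=
  {K | IsCompactOperator K ∧ ‖K‖ ≤ 1}

/-! Let `r` be the distance from `T` to the compact unit ball; then `‖T‖ - 1 ≤ r ≤ ‖T‖`. The best
approximation is `K = f(T)`, with `f` soft thresholding at `r`. Since `|t - f t| ≤ r`, `‖T - K‖ ≤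
r`; since `|f| ≤ ‖T‖ - r` on `[-‖T‖, ‖T‖]`, `‖K‖ ≤ 1`; since `f ≥ 0` on `[0, ∞)`, positivity passes
to `K`. For compactness, take a self-adjoint compact `C` with `‖T - C‖ ≤ r + δ`. Modulo compact
operators `f(T)` equals `f(T - C)`, whose norm is at most `δ`, so `K` is a limit of compact
operators. Here `f(T)` is a norm limit of real polynomials in `T`, controlled over both scalar
fields by `norm_realAeval_le`, which rests on `exists_quadrature`. -/

open Polynomial in
/-- The value at an operator of a polynomial with real coefficients. -/
noncomputable def realAeval {𝕜 H : Type*} [RCLike 𝕜] [NormedAddCommGroup H]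
    [InnerProductSpace 𝕜 H] (T : H →L[𝕜] H) (p : ℝ[X]) : H →L[𝕜] H :=
  aeval T (p.map (algebraMap ℝ 𝕜))

section

open Polynomial Filter Topology

variable {𝕜 H : Type*} [RCLike 𝕜] [NormedAddCommGroup H] [InnerProductSpace 𝕜 H]

/-! ### Real polynomials of a self-adjoint operator -/

theorem realAeval_sub (T : H →L[𝕜] H) (p q : ℝ[X]) :
    realAeval T (p - q) = realAeval T p - realAeval T q := by
  simp [realAeval]

theorem realAeval_mul (T : H →L[𝕜] H) (p q : ℝ[X]) :
    realAeval T (p * q) = realAeval T p * realAeval T q := by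
  simp [realAeval]

theorem realAeval_X (T : H →L[𝕜] H) : realAeval T X = T := by
  simp [realAeval]

theorem realAeval_eq_sum (T : H →L[𝕜] H) (p : ℝ[X]) :
    realAeval T p =
      ∑ i ∈ Finset.range (p.natDegree + 1), ((p.coeff i : ℝ) : 𝕜) • T ^ i := by
  rw [realAeval, aeval_eq_sum_range' (n := p.natDegree + 1)]
  · simp
  · exact Nat.lt_succ_of_le natDegree_map_le

theorem isSelfAdjoint_realAeval [CompleteSpace H] {T : H →L[𝕜] H} (hT : IsSelfAdjoint T)
    (p : ℝ[X]) : IsSelfAdjoint (realAeval T p) := by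
  rw [realAeval_eq_sum]
  refine isSelfAdjoint_sum _ fun i _ => ?_
  refine IsSelfAdjoint.smul ?_ (hT.pow i)
  simp [isSelfAdjoint_iff]

/-- Gauss quadrature for a symmetric operator: the quadratic form of a polynomial of bounded degree
in `T` is a nonnegative combination of values of the polynomial at Rayleigh quotients of `T`. -/
theorem exists_quadrature {T : H →L[𝕜] H} (hT : T.IsSymmetric) (x : H) (N : ℕ) :
    ∃ (n : ℕ) (v : Fin n → H) (w : Fin n → ℝ), (∀ i, ‖v i‖ = 1) ∧ (∀ i, 0 ≤ w i) ∧
      ∑ i, w i = ‖x‖ ^ 2 ∧ ∀ p : ℝ[X], p.natDegree ≤ N →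
        RCLike.re (inner 𝕜 (realAeval T p x) x) =
          ∑ i, p.eval (RCLike.re (inner 𝕜 (T (v i)) (v i))) * w i := by
  -- The compression `A` of `T` to this Krylov space has the same moments at `x` up to order `N`.
  -- Its eigenvalues are the nodes, and the squared coordinates of `x` in its eigenbasis are the
  -- weights.
  let V : Submodule 𝕜 H := Submodule.span 𝕜 (Set.range fun k : Fin (N + 1) => (T ^ (k : ℕ)) x)
  have : FiniteDimensional 𝕜 V := FiniteDimensional.span_of_finite 𝕜 (Set.finite_range _)
  have hmem : ∀ k ≤ N, (T ^ k) x ∈ V := fun k hk =>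
    Submodule.subset_span ⟨⟨k, Nat.lt_succ_of_le hk⟩, rfl⟩
  let A : V →ₗ[𝕜] V := (V.orthogonalProjectionOnto ∘L T ∘L V.subtypeL : V →L[𝕜] V).toLinearMap
  have hAapp : ∀ u : V, A u = V.orthogonalProjectionOnto (T u) := fun u => rfl
  have hAin : ∀ u v : V, inner 𝕜 (A u) v = inner 𝕜 (T u) (v : H) := fun u v => by
    rw [hAapp, Submodule.inner_orthogonalProjectionOnto_eq_of_mem_right]
  have hA : A.IsSymmetric := fun u v => by
    rw [hAin, ← inner_conj_symm u, hAin, inner_conj_symm]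
    exact hT u v
  let y : V := ⟨x, by simpa using hmem 0 (Nat.zero_le N)⟩
  have hpow : ∀ k ≤ N, (((A ^ k) y : V) : H) = (T ^ k) x := by
    intro k
    induction k with
    | zero => intro _; simp [y]
    | succ k ih =>
      intro hk
      rw [pow_succ', Module.End.mul_apply, hAapp, ih (by omega), pow_succ',
        mul_apply_eq_comp]
      apply Submodule.starProjection_eq_self_iff.mpr
      simpa [pow_succ'] using hmem (k + 1) hk
  let b := hA.eigenvectorBasis rfl
  let μ := hA.eigenvalues rfl
  have hAb : ∀ i, A (b i) = ((μ i : ℝ) : 𝕜) • b i := hA.apply_eigenvectorBasis rfl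
  have hμ : ∀ i, RCLike.re (inner 𝕜 (T (b i : H)) (b i : H)) = μ i := fun i => by
    rw [← hAin, hAb, inner_smul_left, inner_self_eq_norm_sq_to_K, b.norm_eq_one]
    simp
  have hrepr : ∀ k i, b.repr ((A ^ k) y) i = ((μ i : ℝ) : 𝕜) ^ k * b.repr y i := by
    intro k i
    induction k with
    | zero => simp
    | succ k ih =>
      rw [pow_succ', Module.End.mul_apply]
      rw [hA.eigenvectorBasis_apply_self_apply rfl, ih, pow_succ']
      ring
  have hmoment : ∀ k ≤ N, RCLike.re (inner 𝕜 ((T ^ k) x) x) = ∑ i, μ i ^ k * ‖b.repr y i‖ ^ 2 := by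
    intro k hk
    rw [← hpow k hk]
    change RCLike.re (inner 𝕜 ((A ^ k) y) y) = _
    rw [← b.repr.inner_map_map, PiLp.inner_apply, map_sum]
    refine Finset.sum_congr rfl fun i _ => ?_
    have hconj : (starRingEnd 𝕜) (((μ i : ℝ) : 𝕜) ^ k * b.repr y i) =
        ((μ i : ℝ) : 𝕜) ^ k * (starRingEnd 𝕜) (b.repr y i) := by simp
    rw [hrepr, RCLike.inner_apply, hconj, mul_left_comm, RCLike.mul_conj]
    norm_cast
  refine ⟨_, fun i => (b i : H), fun i => ‖b.repr y i‖ ^ 2, fun i => b.norm_eq_one i,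
    fun i => by positivity, ?_, fun p hp => ?_⟩
  · have := hmoment 0 (Nat.zero_le N)
    simpa using this.symm
  · simp_rw [hμ, eval_eq_sum_range, Finset.sum_mul]
    rw [Finset.sum_comm, realAeval_eq_sum, sum_apply, sum_inner, map_sum]
    refine Finset.sum_congr rfl fun k hk => ?_
    have hk' : k ≤ N := by have := Finset.mem_range.mp hk; omega
    rw [smul_apply, inner_smul_left, RCLike.conj_ofReal, RCLike.re_ofReal_mul,
      hmoment k hk', Finset.mul_sum]
    exact Finset.sum_congr rfl fun i _ => (mul_assoc _ _ _).symm

theorem abs_re_inner_le_norm_of_norm_eq_one (T : H →L[𝕜] H) {v : H} (hv : ‖v‖ = 1) :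
    |RCLike.re (inner 𝕜 (T v) v)| ≤ ‖T‖ := by
  calc |RCLike.re (inner 𝕜 (T v) v)| ≤ ‖T v‖ * ‖v‖ :=
        (RCLike.abs_re_le_norm _).trans (norm_inner_le_norm _ _)
    _ ≤ ‖T‖ := by simpa [hv] using T.le_opNorm v

/-- Quadrature applied to `p * p` writes `‖p(T) x‖ ^ 2` as a sum of values of `p ^ 2` on `[-‖T‖,
‖T‖]` with total weight `‖x‖ ^ 2`. -/
theorem norm_realAeval_le [CompleteSpace H] {T : H →L[𝕜] H} (hT : IsSelfAdjoint T) {p : ℝ[X]}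
    {c : ℝ} (hp : ∀ t, |t| ≤ ‖T‖ → |p.eval t| ≤ c) : ‖realAeval T p‖ ≤ c := by
  have hc : 0 ≤ c := (abs_nonneg _).trans (hp 0 (by simp))
  refine ContinuousLinearMap.opNorm_le_bound _ hc fun x => ?_
  obtain ⟨n, v, w, hv, hw, hsum, hquad⟩ := exists_quadrature hT.isSymmetric x (p * p).natDegree
  have hsq : ‖realAeval T p x‖ ^ 2 = RCLike.re (inner 𝕜 (realAeval T (p * p) x) x) := by
    rw [realAeval_mul, mul_apply_eq_comp,
      (isSelfAdjoint_realAeval hT p).isSymmetric.apply_clm, inner_self_eq_norm_sq]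
  refine abs_le_of_sq_le_sq' ?_ (by positivity) |>.2
  rw [hsq, hquad _ le_rfl, mul_pow, ← hsum, Finset.mul_sum]
  refine Finset.sum_le_sum fun i _ => mul_le_mul_of_nonneg_right ?_ (hw i)
  rw [eval_mul, ← sq, ← sq_abs]
  exact pow_le_pow_left₀ (abs_nonneg _) (hp _ (abs_re_inner_le_norm_of_norm_eq_one T (hv i))) 2

theorem le_re_inner_realAeval {T : H →L[𝕜] H} (hT : T.IsPositive) {p : ℝ[X]}
    {c : ℝ} (hp : ∀ t, 0 ≤ t → t ≤ ‖T‖ → c ≤ p.eval t) (x : H) :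
    c * ‖x‖ ^ 2 ≤ RCLike.re (inner 𝕜 (realAeval T p x) x) := by
  obtain ⟨n, v, w, hv, hw, hsum, hquad⟩ := exists_quadrature hT.isSymmetric x p.natDegree
  rw [hquad _ le_rfl, ← hsum, Finset.mul_sum]
  refine Finset.sum_le_sum fun i _ => mul_le_mul_of_nonneg_right ?_ (hw i)
  exact hp _ (hT.re_inner_nonneg_left _)
    ((le_abs_self _).trans (abs_re_inner_le_norm_of_norm_eq_one T (hv i)))

/-! ### Compact perturbations and adjoints -/

theorem IsCompactOperator.pow_sub_pow {T S : H →L[𝕜] H} (h : IsCompactOperator (T - S)) (k : ℕ) :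
    IsCompactOperator (T ^ k - S ^ k) := by
  induction k with
  | zero => simpa using isCompactOperator_zero
  | succ k ih =>
    have : T ^ (k + 1) - S ^ (k + 1) = T ^ k * (T - S) + (T ^ k - S ^ k) * S := by
      rw [pow_succ, pow_succ]; noncomm_ring
    rw [this]
    exact (h.clm_comp (T ^ k)).add (ih.comp_clm S)

theorem IsCompactOperator.realAeval_sub_realAeval {T S : H →L[𝕜] H}
    (h : IsCompactOperator (T - S)) (p : ℝ[X]) :
    IsCompactOperator (realAeval T p - realAeval S p) := by
  rw [realAeval_eq_sum, realAeval_eq_sum, ← Finset.sum_sub_distrib]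
  refine Submodule.sum_mem (compactOperator (RingHom.id 𝕜) H H) fun i _ => ?_
  rw [← smul_sub]
  exact Submodule.smul_mem _ _ (h.pow_sub_pow i)

/-- The adjoint of a compact operator on a Hilbert space is compact. -/
theorem IsCompactOperator.adjoint [CompleteSpace H] {C : H →L[𝕜] H} (hC : IsCompactOperator C) :
    IsCompactOperator (ContinuousLinearMap.adjoint C) := by
  set D := ContinuousLinearMap.adjoint C
  have hCD : IsCompactOperator (C ∘L D) := hC.comp_clm D
  refine (isCompactOperator_iff_isCompact_closure_image_closedBall (D : H →ₗ[𝕜] H) one_pos).mpr ?_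
  refine TotallyBounded.isCompact_of_isClosed (TotallyBounded.closure ?_) isClosed_closure
  have htb : TotallyBounded ((C ∘L D) '' Metric.closedBall 0 1) :=
    (hCD.isCompact_closure_image_closedBall (f := ((C ∘L D : H →L[𝕜] H) : H →ₗ[𝕜] H))
      1).totallyBounded.subset subset_closure
  -- Since `‖D u‖ ^ 2 ≤ ‖C (D u)‖ * ‖u‖` and differences in the unit ball have norm at most 2, an `ε
  -- ^ 2 / 4`-net for `C ∘L D` gives an `ε`-net for `D`.
  refine Metric.totallyBounded_iff.mpr fun ε hε => ?_
  obtain ⟨t, hts, htfin, hcover⟩ := (totallyBounded_iff_subset.mp htb) _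
    (Metric.dist_mem_uniformity (show 0 < ε ^ 2 / 4 by positivity))
  obtain ⟨s, hs, hsfin, rfl⟩ := htfin.exists_subset_finite_image_eq hts
  refine ⟨D '' s, hsfin.image D, ?_⟩
  rintro _ ⟨a, ha, rfl⟩
  obtain ⟨_, hy, haz⟩ := Set.mem_iUnion₂.mp (hcover (Set.mem_image_of_mem (C ∘L D) ha))
  obtain ⟨z, hz, rfl⟩ := hy
  refine Set.mem_iUnion₂.mpr ⟨D z, Set.mem_image_of_mem D hz, ?_⟩
  have haz' : ‖C (D (a - z))‖ < ε ^ 2 / 4 := by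
    simpa [dist_eq_norm] using haz
  have hnorm : ‖a - z‖ ≤ 2 := by
    have h1 : ‖a‖ ≤ 1 := by simpa using ha
    have h2 : ‖z‖ ≤ 1 := by simpa using hs hz
    exact (norm_sub_le a z).trans (by linarith)
  have hsq : ‖D (a - z)‖ ^ 2 ≤ ‖C (D (a - z))‖ * ‖a - z‖ := by
    rw [← inner_self_eq_norm_sq (𝕜 := 𝕜), ContinuousLinearMap.adjoint_inner_right]
    exact (RCLike.re_le_norm _).trans (norm_inner_le_norm _ _)
  change dist (D a) (D z) < ε
  rw [dist_eq_norm, ← map_sub]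
  refine lt_of_pow_lt_pow_left₀ 2 hε.le ?_
  nlinarith [norm_nonneg (C (D (a - z)))]

/-- A norm limit of real polynomials in `T`, along polynomials converging uniformly to `f` on
`[-M, M]`, exists as soon as `‖T‖ ≤ M`. -/
theorem exists_tendsto_realAeval [CompleteSpace H] {T : H →L[𝕜] H} (hT : IsSelfAdjoint T) {M : ℝ}
    (hM : ‖T‖ ≤ M) {f : ℝ → ℝ} (hf : Continuous f) :
    ∃ (p : ℕ → ℝ[X]) (K : H →L[𝕜] H),
      (∀ n t, |t| ≤ M → |(p n).eval t - f t| ≤ 1 / ((n : ℝ) + 1)) ∧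
      Tendsto (fun n => realAeval T (p n)) atTop (𝓝 K) := by
  choose p hp using fun n : ℕ => exists_polynomial_near_of_continuousOn (-M) M f hf.continuousOn
    (1 / ((n : ℝ) + 1)) Nat.one_div_pos_of_nat
  have hp' : ∀ n t, |t| ≤ M → |(p n).eval t - f t| ≤ 1 / ((n : ℝ) + 1) := fun n t ht =>
    (hp n t (abs_le.mp ht)).le
  have hcauchy : CauchySeq fun n => realAeval T (p n) := by
    refine cauchySeq_of_le_tendsto_0 (fun n : ℕ => 2 * (1 / ((n : ℝ) + 1))) (fun n m N hn hm => ?_)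
      (by simpa using tendsto_one_div_add_atTop_nhds_zero_nat.const_mul (2 : ℝ))
    rw [dist_eq_norm, ← realAeval_sub]
    refine norm_realAeval_le hT fun t ht => ?_
    rw [eval_sub]
    have h1 := (hp' n t (ht.trans hM)).trans (Nat.one_div_le_one_div hn)
    have h2 := (hp' m t (ht.trans hM)).trans (Nat.one_div_le_one_div hm)
    rw [abs_le] at *
    constructor <;> linarith
  obtain ⟨K, hK⟩ := cauchySeq_tendsto_of_complete hcauchy
  exact ⟨p, K, hp', hK⟩

/-! ### Soft thresholding and best approximation -/

/-- The soft thresholding function `t ↦ sign t * max (|t| - r) 0`. -/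
def softThreshold (r t : ℝ) : ℝ := t - max (-r) (min r t)

theorem continuous_softThreshold (r : ℝ) : Continuous (softThreshold r) := by
  unfold softThreshold; fun_prop

theorem abs_softThreshold_le {r s t : ℝ} (hrs : r ≤ s) (ht : |t| ≤ s) :
    |softThreshold r t| ≤ s - r := by
  unfold softThreshold
  rw [abs_le] at *
  rcases max_cases (-r) (min r t) with h | h <;> rcases min_cases r t with h' | h' <;>
    constructor <;> linarith

theorem abs_sub_softThreshold_le {r : ℝ} (hr : 0 ≤ r) (t : ℝ) : |t - softThreshold r t| ≤ r := by
  rw [softThreshold, sub_sub_cancel, abs_le]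
  exact ⟨le_max_left _ _, max_le (by linarith) (min_le_left _ _)⟩

theorem softThreshold_nonneg {r t : ℝ} (hr : 0 ≤ r) (ht : 0 ≤ t) : 0 ≤ softThreshold r t :=
  sub_nonneg.mpr (max_le (by linarith) (min_le_right _ _))

/-- Soft thresholding of a self-adjoint operator `T` at a level `r` that bounds the distance from
`T` to the compact operators yields a compact operator within `r` of `T`. -/
theorem exists_compact_softThreshold [CompleteSpace H] {T : H →L[𝕜] H} (hT : IsSelfAdjoint T)
    {r : ℝ} (hr : 0 ≤ r) (hrT : r ≤ ‖T‖)
    (hdist : ∀ ε > 0, ∃ C : H →L[𝕜] H, IsCompactOperator C ∧ ‖T - C‖ < r + ε) :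
    ∃ K : H →L[𝕜] H, IsSelfAdjoint K ∧ (T.IsPositive → K.IsPositive) ∧ IsCompactOperator K ∧
      ‖K‖ ≤ ‖T‖ - r ∧ ‖T - K‖ ≤ r := by
  -- The extra 1 leaves room for compact perturbations of `T` of norm up to `r + δ`, with `δ ≤ 1`.
  obtain ⟨p, K, hp, hK⟩ := exists_tendsto_realAeval hT (M := ‖T‖ + 1) (by linarith)
    (continuous_softThreshold r)
  have hlim : ∀ c : ℝ, Tendsto (fun n : ℕ => c + 1 / ((n : ℝ) + 1)) atTop (𝓝 c) := fun c => by
    simpa using tendsto_one_div_add_atTop_nhds_zero_nat.const_add c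
  have hKsa : IsSelfAdjoint K :=
    tendsto_nhds_unique ((ContinuousLinearMap.adjoint.continuous.tendsto K).comp hK)
      (hK.congr fun n => (isSelfAdjoint_realAeval hT (p n)).star_eq.symm)
  refine ⟨K, hKsa, fun hpos => ⟨hKsa.isSymmetric, fun x => ?_⟩, ?_, ?_, ?_⟩
  · have h1 : Tendsto (fun n => RCLike.re (inner 𝕜 (realAeval T (p n) x) x)) atTop
        (𝓝 (RCLike.re (inner 𝕜 (K x) x))) :=
      (RCLike.continuous_re.tendsto _).comp
        (((ContinuousLinearMap.apply 𝕜 H x).continuous.tendsto K).comp hK |>.inner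
          tendsto_const_nhds)
    have h2 : Tendsto (fun n : ℕ => -(1 / ((n : ℝ) + 1)) * ‖x‖ ^ 2) atTop (𝓝 0) := by
      simpa using (tendsto_one_div_add_atTop_nhds_zero_nat (𝕜 := ℝ)).neg.mul_const (‖x‖ ^ 2)
    refine le_of_tendsto_of_tendsto' h2 h1 fun n => le_re_inner_realAeval hpos (fun t h0 ht => ?_) x
    have := abs_le.mp (hp n t (by rw [abs_of_nonneg h0]; linarith))
    linarith [softThreshold_nonneg hr h0]
  · suffices h : K ∈ closure {L : H →L[𝕜] H | IsCompactOperator L} by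
      rwa [isClosed_setOfPred_isCompactOperator.closure_eq] at h
    refine Metric.mem_closure_iff.mpr fun ε hε => ?_
    obtain ⟨δ, hδ, hδ1, hδε⟩ : ∃ δ > 0, δ ≤ 1 ∧ δ ≤ ε / 4 :=
      ⟨min 1 (ε / 4), by positivity, min_le_left _ _, min_le_right _ _⟩
    obtain ⟨C, hC, hTC⟩ := hdist δ hδ
    -- As `T` is self-adjoint, replacing `C` by its self-adjoint part does not increase the distance
    -- to `T`.
    let C' : H →L[𝕜] H := ((2⁻¹ : ℝ) : 𝕜) • (C + ContinuousLinearMap.adjoint C)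
    have hC' : IsCompactOperator C' := (hC.add hC.adjoint).smul _
    have hS : IsSelfAdjoint (T - C') := by
      refine hT.sub (IsSelfAdjoint.smul (by simp [isSelfAdjoint_iff]) ?_)
      exact IsSelfAdjoint.add_star_self C
    have hSnorm : ‖T - C'‖ ≤ r + δ := by
      have hdecomp : T - C' = ((2⁻¹ : ℝ) : 𝕜) • ((T - C) + star (T - C)) := by
        rw [star_sub, hT.star_eq, ContinuousLinearMap.star_eq_adjoint,
          show T - C + (T - ContinuousLinearMap.adjoint C)
            = (2 : 𝕜) • T - (C + ContinuousLinearMap.adjoint C) by rw [two_smul]; abel,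
          smul_sub, smul_smul]
        have h2 : ((2⁻¹ : ℝ) : 𝕜) * 2 = 1 := by
          rw [RCLike.ofReal_inv, RCLike.ofReal_ofNat]
          exact inv_mul_cancel₀ two_ne_zero
        rw [h2, one_smul]
      rw [hdecomp, norm_smul, RCLike.norm_ofReal]
      have hadd := norm_add_le (T - C) (star (T - C))
      have hstar : ‖star (T - C)‖ = ‖T - C‖ := ContinuousLinearMap.adjoint.norm_map (T - C)
      rw [abs_of_pos (by norm_num)]
      linarith
    obtain ⟨n, hn1, hn2⟩ := ((Metric.tendsto_nhds.mp hK (ε / 2) (by positivity)).and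
      (tendsto_one_div_add_atTop_nhds_zero_nat.eventually_lt_const
        (show (0 : ℝ) < ε / 4 by positivity))).exists
    -- Thresholding at `r` leaves at most `δ` on `[-(r + δ), r + δ]`.
    have hpS : ‖realAeval (T - C') (p n)‖ ≤ δ + 1 / ((n : ℝ) + 1) := by
      refine norm_realAeval_le hS fun t ht => ?_
      have h1 := hp n t (by linarith)
      have h2 := abs_softThreshold_le (le_add_of_nonneg_right hδ.le) (ht.trans hSnorm)
      rw [abs_le] at *
      constructor <;> linarith
    refine ⟨realAeval T (p n) - realAeval (T - C') (p n),
      IsCompactOperator.realAeval_sub_realAeval (by simpa using hC') (p n), ?_⟩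
    rw [dist_comm, dist_eq_norm]
    rw [dist_eq_norm] at hn1
    calc ‖realAeval T (p n) - realAeval (T - C') (p n) - K‖
        = ‖(realAeval T (p n) - K) - realAeval (T - C') (p n)‖ := by congr 1; abel
      _ ≤ ‖realAeval T (p n) - K‖ + ‖realAeval (T - C') (p n)‖ := norm_sub_le _ _
      _ < ε := by linarith
  · refine le_of_tendsto_of_tendsto' hK.norm (hlim (‖T‖ - r)) fun n =>
      norm_realAeval_le hT fun t ht => ?_
    have h1 := hp n t (by linarith)
    have h2 := abs_softThreshold_le hrT ht
    rw [abs_le] at *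
    constructor <;> linarith
  · refine le_of_tendsto_of_tendsto' (hK.const_sub T).norm (hlim r) fun n => ?_
    rw [show T - realAeval T (p n) = realAeval T (X - p n) by rw [realAeval_sub, realAeval_X]]
    refine norm_realAeval_le hT fun t ht => ?_
    have h1 := hp n t (by linarith)
    have h2 := abs_sub_softThreshold_le hr t
    rw [eval_sub, eval_X]
    rw [abs_le] at *
    constructor <;> linarith

end

/-- A self-adjoint operator has a self-adjoint best approximation in the unit
ball of the compact operators, which is positive when the operator is. -/
theorem exists_best_approximation {𝕜 H : Type*} [RCLike 𝕜] [NormedAddCommGroup H]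
    [InnerProductSpace 𝕜 H] [CompleteSpace H] {T : H →L[𝕜] H} (hT : IsSelfAdjoint T) :
    ∃ K : H →L[𝕜] H, IsSelfAdjoint K ∧ (T.IsPositive → K.IsPositive) ∧ IsCompactOperator K ∧
      ‖K‖ ≤ 1 ∧ ‖T - K‖ = Metric.infDist T (compactUnitBall 𝕜 H) := by
  have hzero : (0 : H →L[𝕜] H) ∈ compactUnitBall 𝕜 H := ⟨isCompactOperator_zero, by simp⟩
  have hlower : ‖T‖ - 1 ≤ Metric.infDist T (compactUnitBall 𝕜 H) := by
    refine (Metric.le_infDist ⟨0, hzero⟩).mpr fun L hL => ?_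
    rw [dist_eq_norm]
    linarith [norm_sub_norm_le T L, hL.2]
  have hupper : Metric.infDist T (compactUnitBall 𝕜 H) ≤ ‖T‖ := by
    simpa using Metric.infDist_le_dist_of_mem (x := T) hzero
  obtain ⟨K, hsa, hpos, hcomp, hnorm, hle⟩ :=
    exists_compact_softThreshold hT Metric.infDist_nonneg hupper fun ε hε => by
      obtain ⟨C, hC, hTC⟩ := (Metric.infDist_lt_iff ⟨0, hzero⟩).mp
        (lt_add_of_pos_right (Metric.infDist T (compactUnitBall 𝕜 H)) hε)
      exact ⟨C, hC.1, by rwa [dist_eq_norm] at hTC⟩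
  -- `‖K‖ ≤ ‖T‖ - r`, and `hlower` bounds this by 1.
  have hK1 : ‖K‖ ≤ 1 := by linarith
  refine ⟨K, hsa, hpos, hcomp, hK1, hle.antisymm ?_⟩
  rw [← dist_eq_norm]
  exact Metric.infDist_le_dist_of_mem ⟨hcomp, hK1⟩

theorem mainTheorem7 {𝕜 H : Type*} [RCLike 𝕜] [NormedAddCommGroup H] [InnerProductSpace 𝕜 H]
    [CompleteSpace H] [TopologicalSpace.SeparableSpace H]
    (T : H →L[𝕜] H) (hT : 1 ≤ ‖T‖) :
    (T.IsPositive →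
      ∃ K : H →L[𝕜] H, K.IsPositive ∧ IsCompactOperator K ∧ ‖K‖ ≤ 1 ∧
        ‖T - K‖ = Metric.infDist T (compactUnitBall 𝕜 H)) ∧
    (IsSelfAdjoint T →
      ∃ K : H →L[𝕜] H, IsSelfAdjoint K ∧ IsCompactOperator K ∧ ‖K‖ ≤ 1 ∧
        ‖T - K‖ = Metric.infDist T (compactUnitBall 𝕜 H)) := by
  refine ⟨fun h => ?_, fun h => ?_⟩
  · obtain ⟨K, -, hpos, hK⟩ := exists_best_approximation h.isSelfAdjoint
    exact ⟨K, hpos h, hK⟩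
  · obtain ⟨K, hsa, -, hK⟩ := exists_best_approximation h
    exact ⟨K, hsa, hK⟩
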